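/- Let $D$ be the open unit disk in $\mathbb{C}$ and let $H^2(D)$ be the Hardy space of analytic functions $f$ on $D$ with $\|f\|^2=\sup_{0<r<1}\int_0^{2\pi}|f(re^{i\theta})|^2\,\frac{d\theta}{2\pi}<\infty$, a Hilbert space with inner product $\langle f,g\rangle=\lim_{r\to1^-}\int_0^{2\pi}f(re^{i\theta})\overline{g(re^{i\theta})}\,\frac{d\theta}{2\pi}$. A conjugation on a complex Hilbert space $\mathcal H$ is a map $C:\mathcal H\to\mathcal H$ such that $C(\lambda x+\mu y)=\overline{\lambda}Cx+\overline{\mu}Cy$, $\langle Cx,Cy\rangle=\langle y,x\rangle$ and $C(Cx)=x$ for all $x,y\in\mathcal H$ and $\lambda,\mu\in\mathbb C$. A bounded operator $T$ on $\mathcal H$ is complex symmetric if $T=CT^*C$ for some conjugation $C$. Let $\varphi$ be an elliptic automorphism of $D$ (a biholomorphic self-map of $D$ with a unique fixed point in $D$) of order $3$ (that is, $3$ is the smallest positive integer $n$ whose $n$-th iterate $\varphi_n$ satisfies $\varphi_n(z)=z$ for all $z\in D$), with fixed point $a\in D\setminus\{0\}$. Then the bounded composition operator $C_\varphi f=f\circ\varphi$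 is not complex symmetric on $H^2(D)$. -/

import Mathlib

open scoped Complex.UnitDisc

noncomputable section

namespace HardyDisc

/-! ### Circle means of power series -/

theorem circleAverage_conj {F : ℂ → ℂ} {r : ℝ} (hF : CircleIntegrable F 0 r) :
    Real.circleAverage (fun z => starRingEnd ℂ (F z)) 0 r
      = starRingEnd ℂ (Real.circleAverage F 0 r) := by
  have := (Complex.conjCLE : ℂ ≃L[ℝ] ℂ).toContinuousLinearMap.circleAverage_comp_comm hF
  simpa [Function.comp_def] using this

theorem circleAverage_conj_pow_mul_pow_of_le {r : ℝ} (hr : 0 < r) {n m : ℕ} (h : n ≤ m) :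
    Real.circleAverage (fun z => starRingEnd ℂ (z ^ n) * z ^ m) 0 r
      = if n = m then ((r ^ (2 * n) : ℝ) : ℂ) else 0 := by
  obtain ⟨k, rfl⟩ := Nat.exists_eq_add_of_le h
  have h1 : Real.circleAverage (fun z : ℂ => starRingEnd ℂ (z ^ n) * z ^ (n + k)) 0 r
      = Real.circleAverage (fun z : ℂ => ((r ^ (2 * n) : ℝ) : ℂ) * z ^ k) 0 r := by
    apply Real.circleAverage_congr_sphere
    intro z hz
    have hz' : ‖z‖ = r := by simpa [abs_of_pos hr] using hz
    have : starRingEnd ℂ z * z = ((r ^ 2 : ℝ) : ℂ) := by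
      rw [Complex.conj_mul', hz']; push_cast; rfl
    simp only [map_pow]
    rw [pow_add, ← mul_assoc, ← mul_pow, this, pow_mul]
    push_cast; rfl
  rw [h1]
  have hd : Differentiable ℂ (fun z : ℂ => ((r ^ (2 * n) : ℝ) : ℂ) * z ^ k) := by fun_prop
  rw [hd.diffContOnCl.circleAverage]
  rcases Nat.eq_zero_or_pos k with rfl | hk
  · simp
  · rw [zero_pow hk.ne', if_neg (by omega), mul_zero]

theorem circleAverage_conj_pow_mul_pow {r : ℝ} (hr : 0 < r) (n m : ℕ) :
    Real.circleAverage (fun z => starRingEnd ℂ (z ^ n) * z ^ m) 0 r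
      = if n = m then ((r ^ (2 * n) : ℝ) : ℂ) else 0 := by
  rcases le_total n m with h | h
  · exact circleAverage_conj_pow_mul_pow_of_le hr h
  · have h1 : (fun z : ℂ => starRingEnd ℂ (z ^ n) * z ^ m)
        = fun z => starRingEnd ℂ (starRingEnd ℂ (z ^ m) * z ^ n) := by
      funext z; simp [mul_comm]
    rw [h1, circleAverage_conj, circleAverage_conj_pow_mul_pow_of_le hr h]
    · by_cases hnm : m = n
      · subst hnm; simp
      · rw [if_neg hnm, if_neg (Ne.symm hnm), map_zero]
    · apply ContinuousOn.circleIntegrable hr.le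
      exact Continuous.continuousOn
        ((Complex.continuous_conj.comp (continuous_id.pow m)).mul (continuous_id.pow n))

theorem hasSum_circleAverage {f : ℕ → ℂ → ℂ} {g : ℂ → ℂ} {u : ℕ → ℝ} {r : ℝ} (hr : 0 < r)
    (hf : ∀ n, ContinuousOn (f n) (Metric.sphere 0 r)) (hu : Summable u)
    (hb : ∀ n, ∀ z ∈ Metric.sphere (0 : ℂ) r, ‖f n z‖ ≤ u n)
    (hg : ∀ z ∈ Metric.sphere (0 : ℂ) r, HasSum (fun n => f n z) (g z)) :
    HasSum (fun n => Real.circleAverage (f n) 0 r) (Real.circleAverage g 0 r) := by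
  unfold Real.circleAverage
  apply HasSum.const_smul
  have hs : ∀ θ, circleMap 0 r θ ∈ Metric.sphere (0 : ℂ) r :=
    fun θ => circleMap_mem_sphere 0 hr.le θ
  apply intervalIntegral.hasSum_integral_of_dominated_convergence (fun n _ => u n)
  · intro n
    apply Continuous.aestronglyMeasurable
    exact (hf n).comp_continuous (continuous_circleMap 0 r) hs
  · exact fun n => Filter.Eventually.of_forall fun t _ => hb n _ (hs t)
  · exact Filter.Eventually.of_forall fun t _ => hu
  · simp
  · exact Filter.Eventually.of_forall fun t _ => hg _ (hs t)

/-- `a` is the sequence of Taylor coefficients of `F` on the open unit disk. -/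
def HasCoeffs (a : ℕ → ℂ) (F : ℂ → ℂ) : Prop :=
  ∀ z : ℂ, ‖z‖ < 1 → HasSum (fun n => a n * z ^ n) (F z)

theorem exists_hasCoeffs {F : ℂ → ℂ} (hF : DifferentiableOn ℂ F (Metric.ball 0 1)) :
    ∃ a, HasCoeffs a F := by
  refine ⟨fun n => (n.factorial : ℂ)⁻¹ * iteratedDeriv n F 0, fun z hz => ?_⟩
  have := Complex.hasSum_taylorSeries_on_ball hF (z := z) (by simpa using hz)
  convert! this using 2 with n
  simp; ring

theorem HasCoeffs.summable_norm {a : ℕ → ℂ} {F : ℂ → ℂ} (h : HasCoeffs a F) {r : ℝ}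
    (hr : 0 ≤ r) (hr1 : r < 1) : Summable fun n => ‖a n‖ * r ^ n := by
  have := (h (r : ℂ) (by simpa [abs_of_nonneg hr] using hr1)).summable.norm
  simpa [abs_of_nonneg hr] using this

theorem sphere_subset {r : ℝ} (hr1 : r < 1) :
    Metric.sphere (0 : ℂ) r ⊆ Metric.ball 0 1 := by
  intro z hz
  simp at hz ⊢
  linarith

theorem exists_bound {G : ℂ → ℂ} {r : ℝ} (hG : ContinuousOn G (Metric.sphere 0 r)) :
    ∃ M, ∀ z ∈ Metric.sphere (0 : ℂ) r, ‖G z‖ ≤ M :=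
  (isCompact_sphere (0 : ℂ) r).exists_bound_of_continuousOn hG

/-- Parseval's identity on the circle of radius `r`. -/
theorem hasSum_parseval {a b : ℕ → ℂ} {F G : ℂ → ℂ} (ha : HasCoeffs a F) (hb : HasCoeffs b G)
    (hG : DifferentiableOn ℂ G (Metric.ball 0 1)) {r : ℝ} (hr : 0 < r) (hr1 : r < 1) :
    HasSum (fun n => starRingEnd ℂ (a n) * b n * ((r ^ (2 * n) : ℝ) : ℂ))
      (Real.circleAverage (fun z => starRingEnd ℂ (F z) * G z) 0 r) := by
  have hGc : ContinuousOn G (Metric.sphere 0 r) := hG.continuousOn.mono (sphere_subset hr1)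
  have hn : ∀ z ∈ Metric.sphere (0 : ℂ) r, ‖z‖ = r := fun z hz => by simpa using hz
  have hc : ∀ n : ℕ, Continuous fun z : ℂ => starRingEnd ℂ (z ^ n) :=
    fun n => Complex.continuous_conj.comp (continuous_id.pow n)
  have inner1 : ∀ n, Real.circleAverage (fun z => starRingEnd ℂ (z ^ n) * G z) 0 r
      = b n * ((r ^ (2 * n) : ℝ) : ℂ) := by
    intro n
    have h1 := hasSum_circleAverage (f := fun m z => b m * (starRingEnd ℂ (z ^ n) * z ^ m))
      (g := fun z => starRingEnd ℂ (z ^ n) * G z) (u := fun m => r ^ n * (‖b m‖ * r ^ m)) hr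
      (fun m => (continuous_const.mul ((hc n).mul (continuous_id.pow m))).continuousOn)
      ((hb.summable_norm hr.le hr1).mul_left _)
      (fun m z hz => by
        simp only [norm_mul, RCLike.norm_conj, norm_pow, hn z hz]
        apply le_of_eq; ring)
      (fun z hz => by
        have := (hb z (by rw [hn z hz]; exact hr1)).mul_left (starRingEnd ℂ (z ^ n))
        convert! this using 2 with m
        ring)
    refine h1.unique ?_
    have h2 : ∀ m, Real.circleAverage
        (fun z => b m * (starRingEnd ℂ (z ^ n) * z ^ m)) 0 r
        = if m = n then b n * ((r ^ (2 * n) : ℝ) : ℂ) else 0 := by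
      intro m
      have h3 := Real.circleAverage_fun_smul (a := b m)
        (f := fun z : ℂ => starRingEnd ℂ (z ^ n) * z ^ m) (c := 0) (R := r)
      simp only [smul_eq_mul] at h3
      rw [h3, circleAverage_conj_pow_mul_pow hr]
      by_cases hmn : m = n
      · subst hmn; simp
      · rw [if_neg hmn, if_neg (Ne.symm hmn), mul_zero]
    simp only [h2]
    exact hasSum_ite_eq n _
  obtain ⟨M, hM⟩ := exists_bound hGc
  have h1 := hasSum_circleAverage
    (f := fun n z => starRingEnd ℂ (a n) * (starRingEnd ℂ (z ^ n) * G z))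
    (g := fun z => starRingEnd ℂ (F z) * G z) (u := fun n => (‖a n‖ * r ^ n) * M) hr
    (fun n => continuousOn_const.mul ((hc n).continuousOn.mul hGc))
    ((ha.summable_norm hr.le hr1).mul_right _)
    (fun n z hz => by
      simp only [norm_mul, RCLike.norm_conj, norm_pow, hn z hz]
      rw [← mul_assoc]
      have := hM z hz
      gcongr)
    (fun z hz => by
      have h2 := ha z (by rw [hn z hz]; exact hr1)
      have := ((Complex.hasSum_conj'.2 h2)).mul_right (G z)
      convert! this using 2 with m
      simp; ring)
  convert! h1 using 2 with n
  have h3 := Real.circleAverage_fun_smul (a := starRingEnd ℂ (a n))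
    (f := fun z : ℂ => starRingEnd ℂ (z ^ n) * G z) (c := 0) (R := r)
  simp only [smul_eq_mul] at h3
  rw [h3, inner1]; ring

theorem hasSum_parseval_norm {a : ℕ → ℂ} {F : ℂ → ℂ} (ha : HasCoeffs a F)
    (hF : DifferentiableOn ℂ F (Metric.ball 0 1)) {r : ℝ} (hr : 0 < r) (hr1 : r < 1) :
    HasSum (fun n => ‖a n‖ ^ 2 * r ^ (2 * n))
      (Real.circleAverage (fun z => ‖F z‖ ^ 2) 0 r) := by
  have h := Complex.hasSum_re (hasSum_parseval ha ha hF hr hr1)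
  have hFc : ContinuousOn F (Metric.sphere 0 r) := hF.continuousOn.mono (sphere_subset hr1)
  have hi : CircleIntegrable (fun z => starRingEnd ℂ (F z) * F z) 0 r :=
    ContinuousOn.circleIntegrable hr.le ((Complex.continuous_conj.comp_continuousOn hFc).mul hFc)
  have h2 := Complex.reCLM.circleAverage_comp_comm hi
  convert! h using 1
  · funext n
    rw [Complex.conj_mul', ← Complex.ofReal_pow, ← Complex.ofReal_mul, Complex.ofReal_re]
  · rw [← Complex.reCLM_apply, ← h2]
    congr 1
    funext z
    simp [Complex.conj_mul', ← Complex.ofReal_pow]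

theorem summable_of_bddAbove {a : ℕ → ℂ} {F : ℂ → ℂ} (ha : HasCoeffs a F)
    (hF : DifferentiableOn ℂ F (Metric.ball 0 1))
    (hB : BddAbove ((fun r => Real.circleAverage (fun z => ‖F z‖ ^ 2) 0 r) '' Set.Ioo 0 1)) :
    Summable fun n => ‖a n‖ ^ 2 := by
  obtain ⟨M, hM⟩ := hB
  apply summable_of_sum_le (c := M) (fun n => by positivity)
  intro s
  have hc : Filter.Tendsto (fun r : ℝ => ∑ n ∈ s, ‖a n‖ ^ 2 * r ^ (2 * n))
      (nhdsWithin 1 (Set.Iio 1)) (nhds (∑ n ∈ s, ‖a n‖ ^ 2 * 1 ^ (2 * n))) := by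
    have : Continuous fun r : ℝ => ∑ n ∈ s, ‖a n‖ ^ 2 * r ^ (2 * n) := by fun_prop
    exact this.continuousWithinAt
  simp only [one_pow, mul_one] at hc
  refine le_of_tendsto hc ?_
  filter_upwards [Ioo_mem_nhdsLT (show (0 : ℝ) < 1 by norm_num)] with r hr
  have h := hasSum_parseval_norm ha hF hr.1 hr.2
  have hr0 := hr.1
  refine (h.summable.sum_le_tsum s (fun n _ => by positivity)).trans ?_
  rw [h.tsum_eq]
  exact hM ⟨r, hr, rfl⟩

theorem tendsto_parseval {a b : ℕ → ℂ} {F G : ℂ → ℂ} (ha : HasCoeffs a F) (hb : HasCoeffs b G)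
    (hG : DifferentiableOn ℂ G (Metric.ball 0 1)) (hsa : Summable fun n => ‖a n‖ ^ 2)
    (hsb : Summable fun n => ‖b n‖ ^ 2) :
    Filter.Tendsto (fun r => Real.circleAverage (fun z => starRingEnd ℂ (F z) * G z) 0 r)
      (nhdsWithin 1 (Set.Iio 1)) (nhds (∑' n, starRingEnd ℂ (a n) * b n)) := by
  have hmem := Ioo_mem_nhdsLT (show (0 : ℝ) < 1 by norm_num)
  have key : Filter.Tendsto
      (fun r : ℝ => ∑' n, starRingEnd ℂ (a n) * b n * ((r ^ (2 * n) : ℝ) : ℂ))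
      (nhdsWithin 1 (Set.Iio 1)) (nhds (∑' n, starRingEnd ℂ (a n) * b n)) := by
    apply tendsto_tsum_of_dominated_convergence (bound := fun n => ‖a n‖ ^ 2 + ‖b n‖ ^ 2)
      (hsa.add hsb)
    · intro n
      have : Continuous fun r : ℝ => starRingEnd ℂ (a n) * b n * ((r ^ (2 * n) : ℝ) : ℂ) := by
        fun_prop
      simpa using (this.continuousWithinAt (s := Set.Iio 1) (x := 1)).tendsto
    · filter_upwards [hmem] with r hr n
      have h1 : r ^ (2 * n) ≤ 1 := pow_le_one₀ hr.1.le hr.2.le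
      have h0 : 0 ≤ r ^ (2 * n) := pow_nonneg hr.1.le _
      rw [norm_mul, norm_mul, RCLike.norm_conj, Complex.norm_real, Real.norm_eq_abs,
        abs_of_nonneg h0]
      have : ‖a n‖ * ‖b n‖ * r ^ (2 * n) ≤ ‖a n‖ * ‖b n‖ * 1 := by gcongr
      nlinarith [sq_nonneg (‖a n‖ - ‖b n‖), sq_nonneg ‖a n‖, sq_nonneg ‖b n‖]
  refine key.congr' ?_
  filter_upwards [hmem] with r hr
  exact (hasSum_parseval ha hb hG hr.1 hr.2).tsum_eq

theorem differentiableOn_of_hasCoeffs {a : ℕ → ℂ} (hs : Summable fun n => ‖a n‖ ^ 2)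
    {F : ℂ → ℂ} (hF : ∀ z : ℂ, ‖z‖ < 1 → F z = ∑' n, a n * z ^ n) :
    DifferentiableOn ℂ F (Metric.ball 0 1) ∧ HasCoeffs a F := by
  have hsum : ∀ r : ℝ, 0 ≤ r → r < 1 → Summable fun n => ‖a n‖ * r ^ n := by
    intro r h0 h1
    have h2 : Summable fun n : ℕ => (r ^ 2) ^ n :=
      summable_geometric_of_lt_one (by positivity) (by nlinarith)
    refine Summable.of_nonneg_of_le (fun n => by positivity) (fun n => ?_) (hs.add h2)
    have : (r ^ 2) ^ n = (r ^ n) ^ 2 := by ring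
    rw [this]
    nlinarith [sq_nonneg (‖a n‖ - r ^ n), sq_nonneg ‖a n‖, sq_nonneg (r ^ n)]
  refine ⟨fun z hz => ?_, fun z hz => ?_⟩
  · have hz' : ‖z‖ < 1 := by simpa using hz
    obtain ⟨r, h1, h2⟩ := exists_between hz'
    have h0 : 0 ≤ r := (norm_nonneg z).trans h1.le
    have hd : DifferentiableOn ℂ (fun w => ∑' n, a n * w ^ n) (Metric.ball 0 r) := by
      refine Complex.differentiableOn_tsum_of_summable_norm (hsum r h0 h2)
        (fun n => by fun_prop) Metric.isOpen_ball (fun n w hw => ?_)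
      have : ‖w‖ ≤ r := by simpa using (show dist w 0 < r from hw).le
      rw [norm_mul, norm_pow]; gcongr
    have hnh : Metric.ball (0 : ℂ) r ∈ nhds z :=
      Metric.isOpen_ball.mem_nhds (by simpa using h1)
    have hda := (hd.differentiableAt hnh).congr_of_eventuallyEq (f₁ := F) (by
      filter_upwards [hnh] with w hw
      exact hF w ((show ‖w‖ < r by simpa using hw).trans h2))
    exact hda.differentiableWithinAt
  · rw [hF z hz]
    apply Summable.hasSum
    apply Summable.of_norm
    simpa using hsum ‖z‖ (norm_nonneg z) hz


/-! ### The Hardy space -/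

/-- Extension by zero of a function on the open unit disk to the complex plane. -/
def ext (f : 𝔻 → ℂ) (z : ℂ) : ℂ :=
  if h : ‖z‖ < 1 then f (Complex.UnitDisc.mk z h) else 0

theorem ext_of_lt (f : 𝔻 → ℂ) {z : ℂ} (h : ‖z‖ < 1) :
    ext f z = f (Complex.UnitDisc.mk z h) := dif_pos h

@[simp] theorem ext_coe (f : 𝔻 → ℂ) (z : 𝔻) : ext f (z : ℂ) = f z := by
  rw [ext_of_lt f z.norm_lt_one]; rfl

theorem ext_add (f g : 𝔻 → ℂ) : ext (f + g) = fun z => ext f z + ext g z := by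
  funext z; unfold ext; split_ifs <;> simp

theorem ext_smul (c : ℂ) (f : 𝔻 → ℂ) : ext (c • f) = fun z => c * ext f z := by
  funext z; unfold ext; split_ifs <;> simp

theorem ext_zero : ext 0 = fun _ => 0 := by
  funext z; unfold ext; split_ifs <;> simp

theorem ext_injective {f g : 𝔻 → ℂ} (h : ∀ z : ℂ, ‖z‖ < 1 → ext f z = ext g z) : f = g := by
  funext z; simpa using h z z.norm_lt_one

/-- Analyticity of a complex-valued function on the open unit disk. -/
def IsAnalytic (f : 𝔻 → ℂ) : Prop :=
  DifferentiableOn ℂ (ext f) (Metric.ball 0 1)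

/-- The square mean `∫ |f(r e^{iθ})|² dθ / 2π` over `[0, 2π]`. -/
def sqMean (f : 𝔻 → ℂ) (r : ℝ) : ℝ :=
  Real.circleAverage (fun z => ‖ext f z‖ ^ 2) 0 r

/-- The sesquilinear mean `∫ conj (f(r e^{iθ})) g(r e^{iθ}) dθ / 2π` over `[0, 2π]`. -/
def innerMean (f g : 𝔻 → ℂ) (r : ℝ) : ℂ :=
  Real.circleAverage (fun z => starRingEnd ℂ (ext f z) * ext g z) 0 r

theorem continuousOn_ext {f : 𝔻 → ℂ} (hf : IsAnalytic f) {r : ℝ} (hr1 : r < 1) :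
    ContinuousOn (ext f) (Metric.sphere 0 r) :=
  hf.continuousOn.mono (sphere_subset hr1)

theorem circleIntegrable_sq {f : 𝔻 → ℂ} (hf : IsAnalytic f) {r : ℝ} (hr : 0 ≤ r) (hr1 : r < 1) :
    CircleIntegrable (fun z => ‖ext f z‖ ^ 2) 0 r :=
  ContinuousOn.circleIntegrable hr ((continuousOn_ext hf hr1).norm.pow 2)

theorem circleIntegrable_inner {f g : 𝔻 → ℂ} (hf : IsAnalytic f) (hg : IsAnalytic g) {r : ℝ}
    (hr : 0 ≤ r) (hr1 : r < 1) :
    CircleIntegrable (fun z => starRingEnd ℂ (ext f z) * ext g z) 0 r :=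
  ContinuousOn.circleIntegrable hr
    ((Complex.continuous_conj.comp_continuousOn (continuousOn_ext hf hr1)).mul
      (continuousOn_ext hg hr1))

theorem sqMean_nonneg (f : 𝔻 → ℂ) (r : ℝ) : 0 ≤ sqMean f r :=
  Real.circleAverage_nonneg_of_nonneg fun z _ => by positivity

/-- The functions analytic on the open unit disk whose square means over the circles of radius
`0 < r < 1` are bounded, as a subspace of all functions on the disk. -/
def hardySubmodule : Submodule ℂ (𝔻 → ℂ) where
  carrier := {f | IsAnalytic f ∧ BddAbove (sqMean f '' Set.Ioo 0 1)}
  zero_mem' := by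
    refine ⟨?_, 0, ?_⟩
    · rw [IsAnalytic, ext_zero]; fun_prop
    · rintro _ ⟨r, -, rfl⟩
      simp [sqMean, ext_zero, Real.circleAverage_const]
  add_mem' := by
    rintro f g ⟨hf, M, hM⟩ ⟨hg, N, hN⟩
    refine ⟨?_, 2 * M + 2 * N, ?_⟩
    · rw [IsAnalytic, ext_add]; exact DifferentiableOn.add hf hg
    · rintro _ ⟨r, hr, rfl⟩
      have hcf : CircleIntegrable (fun z => (2 : ℝ) • ‖ext f z‖ ^ 2) 0 r :=
        ContinuousOn.circleIntegrable hr.1.le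
          ((continuousOn_const (c := (2 : ℝ))).smul ((continuousOn_ext hf hr.2).norm.pow 2))
      have hcg : CircleIntegrable (fun z => (2 : ℝ) • ‖ext g z‖ ^ 2) 0 r :=
        ContinuousOn.circleIntegrable hr.1.le
          ((continuousOn_const (c := (2 : ℝ))).smul ((continuousOn_ext hg hr.2).norm.pow 2))
      have h1 : sqMean (f + g) r ≤ Real.circleAverage
          (fun z => (2 : ℝ) • ‖ext f z‖ ^ 2 + (2 : ℝ) • ‖ext g z‖ ^ 2) 0 r := by
        unfold sqMean
        apply Real.circleAverage_mono
        · apply ContinuousOn.circleIntegrable hr.1.le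
          rw [ext_add]
          exact (((continuousOn_ext hf hr.2).add (continuousOn_ext hg hr.2)).norm.pow 2)
        · exact hcf.add hcg
        · intro z _
          rw [ext_add]
          have := norm_add_le (ext f z) (ext g z)
          simp only [smul_eq_mul]
          nlinarith [norm_nonneg (ext f z + ext g z), norm_nonneg (ext f z),
            norm_nonneg (ext g z), sq_nonneg (‖ext f z‖ - ‖ext g z‖)]
      rw [Real.circleAverage_fun_add, Real.circleAverage_fun_smul,
        Real.circleAverage_fun_smul] at h1
      · have h2 : sqMean f r ≤ M := hM ⟨r, hr, rfl⟩
        have h3 : sqMean g r ≤ N := hN ⟨r, hr, rfl⟩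
        simp only [smul_eq_mul] at h1
        unfold sqMean at h2 h3
        linarith
      · exact hcf
      · exact hcg
  smul_mem' := by
    rintro c f ⟨hf, M, hM⟩
    refine ⟨?_, ‖c‖ ^ 2 * M, ?_⟩
    · rw [IsAnalytic, ext_smul]; exact DifferentiableOn.const_mul hf c
    · rintro _ ⟨r, hr, rfl⟩
      have h1 : sqMean (c • f) r = ‖c‖ ^ 2 * sqMean f r := by
        unfold sqMean
        rw [ext_smul, ← smul_eq_mul, ← Real.circleAverage_fun_smul]
        simp [mul_pow]
      rw [h1]
      have h2 : sqMean f r ≤ M := hM ⟨r, hr, rfl⟩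
      gcongr

/-- The Hardy–Hilbert space `H²` of the open unit disk. -/
def HardySpace : Type := hardySubmodule

namespace HardySpace

instance : AddCommGroup HardySpace := inferInstanceAs (AddCommGroup hardySubmodule)

instance : Module ℂ HardySpace := inferInstanceAs (Module ℂ hardySubmodule)

instance : CoeFun HardySpace (fun _ => 𝔻 → ℂ) := ⟨fun f => f.1⟩

theorem coe_add (f g : HardySpace) : (f + g : HardySpace).1 = f.1 + g.1 := rfl

theorem coe_smul (c : ℂ) (f : HardySpace) : (c • f : HardySpace).1 = c • f.1 := rfl

theorem ext_fun {f g : HardySpace} (h : ∀ z, f z = g z) : f = g :=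
  Subtype.ext (funext h)

theorem isAnalytic (f : HardySpace) : IsAnalytic f := f.2.1

theorem exists_coeffs (f : HardySpace) :
    ∃ a : ℕ → ℂ, HasCoeffs a (ext f) ∧ Summable fun n => ‖a n‖ ^ 2 := by
  obtain ⟨a, ha⟩ := exists_hasCoeffs f.isAnalytic
  exact ⟨a, ha, summable_of_bddAbove ha f.isAnalytic f.2.2⟩

/-- The inner product of `H²`, conjugate-linear in the first variable: the limit as `r → 1⁻` of
the means of `conj f · g` over the circle of radius `r`. -/
instance : Inner ℂ HardySpace where
  inner f g := Filter.limUnder (nhdsWithin (1 : ℝ) (Set.Iio 1)) (innerMean f g)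

theorem inner_def (f g : HardySpace) :
    inner ℂ f g = Filter.limUnder (nhdsWithin (1 : ℝ) (Set.Iio 1)) (innerMean f g) := rfl

theorem inner_eq_of_tendsto {f g : HardySpace} {c : ℂ}
    (h : Filter.Tendsto (innerMean f g) (nhdsWithin 1 (Set.Iio 1)) (nhds c)) :
    inner ℂ f g = c := h.limUnder_eq

theorem inner_eq_tsum {f g : HardySpace} {a b : ℕ → ℂ} (ha : HasCoeffs a (ext f))
    (hb : HasCoeffs b (ext g)) (hsa : Summable fun n => ‖a n‖ ^ 2)
    (hsb : Summable fun n => ‖b n‖ ^ 2) :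
    inner ℂ f g = ∑' n, starRingEnd ℂ (a n) * b n :=
  inner_eq_of_tendsto (tendsto_parseval ha hb g.isAnalytic hsa hsb)

theorem tendsto_inner (f g : HardySpace) :
    Filter.Tendsto (innerMean f g) (nhdsWithin 1 (Set.Iio 1)) (nhds (inner ℂ f g)) := by
  obtain ⟨a, ha, hsa⟩ := f.exists_coeffs
  obtain ⟨b, hb, hsb⟩ := g.exists_coeffs
  rw [inner_eq_tsum ha hb hsa hsb]
  exact tendsto_parseval ha hb g.isAnalytic hsa hsb

theorem eventually_mem : ∀ᶠ r : ℝ in nhdsWithin 1 (Set.Iio 1), r ∈ Set.Ioo (0 : ℝ) 1 :=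
  Ioo_mem_nhdsLT (by norm_num)

theorem innerMean_self (f : HardySpace) {r : ℝ} (hr : r ∈ Set.Ioo (0 : ℝ) 1) :
    innerMean f f r = (sqMean f r : ℂ) := by
  have h2 := Complex.ofRealCLM.circleAverage_comp_comm
    (circleIntegrable_sq f.isAnalytic hr.1.le hr.2)
  rw [Complex.ofRealCLM_apply] at h2
  unfold innerMean sqMean
  rw [← h2]
  congr 1
  funext z
  simp [Complex.conj_mul']

theorem inner_self_eq_tsum {f : HardySpace} {a : ℕ → ℂ} (ha : HasCoeffs a (ext f))
    (hsa : Summable fun n => ‖a n‖ ^ 2) : inner ℂ f f = ((∑' n, ‖a n‖ ^ 2 : ℝ) : ℂ) := by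
  rw [inner_eq_tsum ha ha hsa hsa, Complex.ofReal_tsum]
  congr 1
  funext n
  simp [Complex.conj_mul']

instance core : InnerProductSpace.Core ℂ HardySpace where
  conj_inner_symm f g := by
    refine (inner_eq_of_tendsto ?_).symm
    have h := (Complex.continuous_conj.tendsto _).comp (tendsto_inner g f)
    refine h.congr' ?_
    filter_upwards [eventually_mem] with r hr
    simp only [Function.comp_apply, innerMean]
    rw [← circleAverage_conj (circleIntegrable_inner g.isAnalytic f.isAnalytic hr.1.le hr.2)]
    congr 1
    funext z
    simp [mul_comm]
  re_inner_nonneg f := by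
    obtain ⟨a, ha, hsa⟩ := f.exists_coeffs
    rw [inner_self_eq_tsum ha hsa]
    simp only [RCLike.re_to_complex, Complex.ofReal_re]
    exact tsum_nonneg fun n => by positivity
  add_left f g h := by
    refine inner_eq_of_tendsto (((tendsto_inner f h).add (tendsto_inner g h)).congr' ?_)
    filter_upwards [eventually_mem] with r hr
    unfold innerMean
    rw [← Real.circleAverage_fun_add
      (circleIntegrable_inner f.isAnalytic h.isAnalytic hr.1.le hr.2)
      (circleIntegrable_inner g.isAnalytic h.isAnalytic hr.1.le hr.2)]
    congr 1
    funext z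
    rw [coe_add, ext_add]
    simp [add_mul]
  smul_left f g c := by
    refine inner_eq_of_tendsto (((tendsto_inner f g).const_mul (starRingEnd ℂ c)).congr' ?_)
    filter_upwards [eventually_mem] with r hr
    unfold innerMean
    rw [← smul_eq_mul, ← Real.circleAverage_fun_smul]
    congr 1
    funext z
    rw [coe_smul, ext_smul]
    simp [mul_assoc]
  definite f h := by
    obtain ⟨a, ha, hsa⟩ := f.exists_coeffs
    rw [inner_self_eq_tsum ha hsa] at h
    have h0 : ∑' n, ‖a n‖ ^ 2 = 0 := by exact_mod_cast h
    have h1 := (hasSum_zero_iff_of_nonneg (fun n => by positivity)).1 (h0 ▸ hsa.hasSum)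
    have h2 : ∀ n, a n = 0 := fun n => by simpa using congrFun h1 n
    refine ext_fun fun z => ?_
    have h3 := ha z z.norm_lt_one
    simp only [h2, zero_mul] at h3
    have h4 := h3.unique hasSum_zero
    rw [ext_coe] at h4
    exact h4

instance : NormedAddCommGroup HardySpace := core.toNormedAddCommGroup

instance : InnerProductSpace ℂ HardySpace := InnerProductSpace.ofCore core.toCore

theorem norm_sq_eq_tsum {f : HardySpace} {a : ℕ → ℂ} (ha : HasCoeffs a (ext f))
    (hsa : Summable fun n => ‖a n‖ ^ 2) : ‖f‖ ^ 2 = ∑' n, ‖a n‖ ^ 2 := by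
  have h := inner_self_eq_norm_sq_to_K (𝕜 := ℂ) f
  have h2 : inner ℂ f f = ((∑' n, ‖a n‖ ^ 2 : ℝ) : ℂ) := inner_self_eq_tsum ha hsa
  rw [h2] at h
  apply Complex.ofReal_injective
  rw [h]
  simp

/-- The norm of `H²` is the usual one: its square is the least upper bound over `0 < r < 1` of
the square means. -/
theorem isLUB_norm_sq (f : HardySpace) : IsLUB (sqMean f '' Set.Ioo 0 1) (‖f‖ ^ 2) := by
  obtain ⟨a, ha, hsa⟩ := f.exists_coeffs
  have hn := norm_sq_eq_tsum ha hsa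
  constructor
  · rintro _ ⟨r, hr, rfl⟩
    have h := hasSum_parseval_norm ha f.isAnalytic hr.1 hr.2
    rw [hn]
    refine hasSum_le (fun n => ?_) h hsa.hasSum
    have h1 : r ^ (2 * n) ≤ 1 := pow_le_one₀ hr.1.le hr.2.le
    nlinarith [sq_nonneg ‖a n‖]
  · intro M hM
    have h := (Complex.continuous_re.tendsto _).comp (tendsto_inner f f)
    rw [inner_self_eq_tsum ha hsa, ← hn, Complex.ofReal_re] at h
    refine le_of_tendsto h ?_
    filter_upwards [eventually_mem] with r hr
    simp only [Function.comp_apply, innerMean_self f hr, Complex.ofReal_re]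
    exact hM ⟨r, hr, rfl⟩

/-- The function with a given square-summable sequence of Taylor coefficients. -/
def ofCoeffsFun (a : ℕ → ℂ) (z : 𝔻) : ℂ := ∑' n, a n * (z : ℂ) ^ n

theorem ofCoeffsFun_spec {a : ℕ → ℂ} (hs : Summable fun n => ‖a n‖ ^ 2) :
    IsAnalytic (ofCoeffsFun a) ∧ HasCoeffs a (ext (ofCoeffsFun a)) :=
  differentiableOn_of_hasCoeffs hs fun z hz => by rw [ext_of_lt _ hz]; rfl

theorem ofCoeffsFun_mem {a : ℕ → ℂ} (hs : Summable fun n => ‖a n‖ ^ 2) :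
    ofCoeffsFun a ∈ hardySubmodule := by
  obtain ⟨h1, h2⟩ := ofCoeffsFun_spec hs
  refine ⟨h1, ∑' n, ‖a n‖ ^ 2, ?_⟩
  rintro _ ⟨r, hr, rfl⟩
  refine hasSum_le (fun n => ?_) (hasSum_parseval_norm h2 h1 hr.1 hr.2) hs.hasSum
  have h1 : r ^ (2 * n) ≤ 1 := pow_le_one₀ hr.1.le hr.2.le
  nlinarith [sq_nonneg ‖a n‖]

theorem summable_lp (a : lp (fun _ : ℕ => ℂ) 2) : Summable fun n => ‖a n‖ ^ 2 := by
  have := (lp.memℓp a).summable (by norm_num)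
  simpa using this

/-- The unitary map from `ℓ²` onto `H²` given by Taylor coefficients. -/
def ofCoeffs : lp (fun _ : ℕ => ℂ) 2 →ₗᵢ[ℂ] HardySpace :=
  LinearMap.isometryOfInner
    { toFun := fun a => ⟨ofCoeffsFun a, ofCoeffsFun_mem (summable_lp a)⟩
      map_add' := fun a b => by
        refine ext_fun fun z => ?_
        have h1 := ((ofCoeffsFun_spec (summable_lp a)).2 z z.norm_lt_one)
        have h2 := ((ofCoeffsFun_spec (summable_lp b)).2 z z.norm_lt_one)
        have h3 := ((ofCoeffsFun_spec (summable_lp (a + b))).2 z z.norm_lt_one)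
        simp only [ext_coe] at h1 h2 h3
        refine h3.unique ?_
        convert! h1.add h2 using 2 with n
        simp [add_mul]
      map_smul' := fun c a => by
        refine ext_fun fun z => ?_
        have h1 := ((ofCoeffsFun_spec (summable_lp a)).2 z z.norm_lt_one)
        have h3 := ((ofCoeffsFun_spec (summable_lp (c • a))).2 z z.norm_lt_one)
        simp only [ext_coe] at h1 h3
        refine h3.unique ?_
        convert! h1.mul_left c using 2 with n
        simp [mul_assoc] }
    (fun a b => by
      have h := inner_eq_tsum (f := ⟨ofCoeffsFun a, ofCoeffsFun_mem (summable_lp a)⟩)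
        (g := ⟨ofCoeffsFun b, ofCoeffsFun_mem (summable_lp b)⟩)
        (ofCoeffsFun_spec (summable_lp a)).2 (ofCoeffsFun_spec (summable_lp b)).2
        (summable_lp a) (summable_lp b)
      refine Eq.trans h ?_
      rw [lp.inner_eq_tsum]
      congr 1
      funext n
      simp [mul_comm])

theorem ofCoeffs_surjective : Function.Surjective ofCoeffs := by
  intro f
  obtain ⟨a, ha, hsa⟩ := f.exists_coeffs
  refine ⟨⟨a, memℓp_gen (by simpa using hsa)⟩, ?_⟩
  refine ext_fun fun z => ?_
  have := (ha z z.norm_lt_one).tsum_eq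
  rw [ext_coe] at this
  exact this

instance : CompleteSpace HardySpace :=
  (LinearIsometryEquiv.ofSurjective ofCoeffs ofCoeffs_surjective).symm.toIsometryEquiv.completeSpace

end HardySpace

/-! ### Composition operators -/

/-- Analyticity of a self-map of the open unit disk. -/
def IsAnalyticSelfMap (φ : 𝔻 → 𝔻) : Prop :=
  IsAnalytic fun z => (φ z : ℂ)

theorem isAnalytic_comp {f : 𝔻 → ℂ} (hf : IsAnalytic f) {φ : 𝔻 → 𝔻} (hφ : IsAnalyticSelfMap φ) :
    IsAnalytic (f ∘ φ) := by
  have h : Set.MapsTo (ext fun z => (φ z : ℂ)) (Metric.ball 0 1) (Metric.ball 0 1) := by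
    intro z hz
    have hz' : ‖z‖ < 1 := by simpa using hz
    rw [ext_of_lt _ hz']
    simpa using (φ _).norm_lt_one
  refine (DifferentiableOn.comp hf hφ h).congr fun z hz => ?_
  have hz' : ‖z‖ < 1 := by simpa using hz
  simp [ext_of_lt _ hz']

theorem poissonKernel_nonneg {s : ℝ} (hs : 0 < s) {w z : ℂ} (hw : ‖w‖ < s) (hz : ‖z‖ = s) :
    0 ≤ poissonKernel 0 w z := by
  rw [poissonKernel_def]
  apply div_nonneg _ (by positivity)
  simp only [sub_zero, hz]
  nlinarith [norm_nonneg w]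

/-- Littlewood's subordination estimate on circles. -/
theorem sqMean_comp_le {f : 𝔻 → ℂ} (hf : IsAnalytic f) {M : ℝ}
    (hM : ∀ r ∈ Set.Ioo (0 : ℝ) 1, sqMean f r ≤ M) {φ : 𝔻 → 𝔻} (hφ : IsAnalyticSelfMap φ)
    {r : ℝ} (hr : r ∈ Set.Ioo (0 : ℝ) 1) :
    sqMean (f ∘ φ) r ≤ (2 * (1 + ‖(φ 0 : ℂ)‖) / (1 - ‖(φ 0 : ℂ)‖)) * M := by
  set Φ : ℂ → ℂ := ext fun z => (φ z : ℂ) with hΦ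
  have hsub : Metric.closedBall (0 : ℂ) r ⊆ Metric.ball 0 1 :=
    Metric.closedBall_subset_ball hr.2
  have hΦc : ContinuousOn Φ (Metric.closedBall 0 r) := hφ.continuousOn.mono hsub
  have hΦlt : ∀ z : ℂ, ‖z‖ < 1 → ‖Φ z‖ < 1 := fun z hz => by
    rw [hΦ, ext_of_lt _ hz]; exact (φ _).norm_lt_one
  have hΦ0 : Φ 0 = (φ 0 : ℂ) := by
    have := ext_coe (fun z => (φ z : ℂ)) 0
    simpa using this
  obtain ⟨z₀, hz₀, hmax⟩ := (isCompact_closedBall (0 : ℂ) r).exists_isMaxOn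
    ⟨0, by simp [hr.1.le]⟩ hΦc.norm
  have hz₀1 : ‖Φ z₀‖ < 1 := hΦlt z₀ (by simpa using hsub hz₀)
  set p : ℝ := ‖(φ 0 : ℂ)‖ with hp
  have hp1 : p < 1 := (φ 0).norm_lt_one
  have hp0 : 0 ≤ p := norm_nonneg _
  obtain ⟨s, hs, hs1⟩ := exists_between (max_lt hz₀1 (show (1 + p) / 2 < 1 by linarith))
  have hs2 : ‖Φ z₀‖ < s := (le_max_left _ _).trans_lt hs
  have hs3 : (1 + p) / 2 < s := (le_max_right _ _).trans_lt hs
  have hs0 : 0 < s := by linarith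
  have hΦs : ∀ z ∈ Metric.closedBall (0 : ℂ) r, Φ z ∈ Metric.ball (0 : ℂ) s := fun z hz => by
    have h : ‖Φ z‖ ≤ ‖Φ z₀‖ := hmax hz
    simpa using h.trans_lt hs2
  -- the harmonic majorant
  set g : ℂ → ℝ := fun ζ => ‖ext f ζ‖ ^ 2 with hg
  have hgi : CircleIntegrable g 0 s := circleIntegrable_sq hf hs0.le hs1
  have hgi' : CircleIntegrable (fun ζ => (g ζ : ℂ)) 0 s :=
    ContinuousOn.circleIntegrable hs0.le (Complex.continuous_ofReal.comp_continuousOn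
      ((continuousOn_ext hf hs1).norm.pow 2))
  set H : ℂ → ℂ := fun w =>
    Real.circleAverage (fun ζ => herglotzRieszKernel 0 w ζ • (g ζ : ℂ)) 0 s with hH
  have hHd : DifferentiableOn ℂ H (Metric.ball 0 s) :=
    differentiableOn_circleAverage_herglotzRieszKernel_smul hgi'
  have hHre : ∀ w ∈ Metric.ball (0 : ℂ) s,
      (H w).re = Real.circleAverage (poissonKernel 0 w • g) 0 s := fun w hw => by
    rw [poissonKernel_eq_re_herglotzRieszKernel]
    exact re_circleAverage_herglotzRieszKernel_smul hgi hw
  have hpc : ∀ w ∈ Metric.ball (0 : ℂ) s,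
      ContinuousOn (poissonKernel 0 w) (Metric.sphere 0 s) := fun w hw => by
    rw [poissonKernel_eq_re_herglotzRieszKernel]
    have := continuousOn_herglotzRieszKernel_sphere hw
    rw [abs_of_pos hs0] at this
    exact Complex.continuous_re.comp_continuousOn this
  have hsn : ∀ z ∈ Metric.sphere (0 : ℂ) s, ‖z‖ = s := fun z hz => by simpa using hz
  have hmaj : ∀ w ∈ Metric.ball (0 : ℂ) s, ‖ext f w‖ ^ 2 ≤ (H w).re := by
    intro w hw
    have hdc : DiffContOnCl ℂ (fun z => ext f z ^ 2) (Metric.ball 0 s) := by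
      apply DifferentiableOn.diffContOnCl
      rw [closure_ball _ hs0.ne']
      exact (DifferentiableOn.pow hf 2).mono (Metric.closedBall_subset_ball hs1)
    have h1 := hdc.circleAverage_poissonKernel_smul hw
    rw [hHre w hw, ← norm_pow, ← h1]
    unfold Real.circleAverage
    rw [norm_smul, smul_eq_mul, Real.norm_of_nonneg (by positivity)]
    gcongr
    refine (intervalIntegral.norm_integral_le_integral_norm Real.two_pi_pos.le).trans
      (le_of_eq ?_)
    congr 1
    funext θ
    have h2 := circleMap_mem_sphere 0 hs0.le θ
    have h3 := poissonKernel_nonneg hs0 (w := w) (by simpa using hw) (hsn _ h2)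
    simp only [Pi.smul_apply', norm_smul, norm_pow, smul_eq_mul, hg, Real.norm_of_nonneg h3]
  have hcd : DiffContOnCl ℂ (fun z => H (Φ z)) (Metric.ball 0 |r|) := by
    rw [abs_of_pos hr.1]
    apply DifferentiableOn.diffContOnCl
    rw [closure_ball _ hr.1.ne']
    exact hHd.comp (hφ.mono hsub) hΦs
  have hsr : Metric.sphere (0 : ℂ) r ⊆ Metric.closedBall 0 r := Metric.sphere_subset_closedBall
  have hHc : ContinuousOn (fun z => H (Φ z)) (Metric.sphere 0 r) :=
    hHd.continuousOn.comp (hΦc.mono hsr) fun z hz => hΦs z (hsr hz)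
  have h0s : Φ 0 ∈ Metric.ball (0 : ℂ) s := hΦs 0 (by simp [hr.1.le])
  have hK : 0 ≤ 2 * (1 + p) / (1 - p) := div_nonneg (by linarith) (by linarith)
  calc sqMean (f ∘ φ) r
      ≤ Real.circleAverage (fun z => (H (Φ z)).re) 0 r := by
        apply Real.circleAverage_mono
        · exact circleIntegrable_sq (isAnalytic_comp hf hφ) hr.1.le hr.2
        · exact ContinuousOn.circleIntegrable hr.1.le
            (Complex.continuous_re.comp_continuousOn hHc)
        · intro z hz
          rw [abs_of_pos hr.1] at hz
          have hz1 : ‖z‖ < 1 := by simpa using hsub (hsr hz)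
          have h1 := hmaj (Φ z) (hΦs z (hsr hz))
          have h2 : ext (f ∘ φ) z = ext f (Φ z) := by
            rw [hΦ, ext_of_lt _ hz1, ext_of_lt (fun z => (φ z : ℂ)) hz1, ext_coe]; rfl
          rw [h2]; exact h1
    _ = (H (Φ 0)).re := by
        have h1 := Complex.reCLM.circleAverage_comp_comm
          (ContinuousOn.circleIntegrable hr.1.le hHc)
        rw [hcd.circleAverage] at h1
        exact h1
    _ = Real.circleAverage (poissonKernel 0 (Φ 0) • g) 0 s := hHre _ h0s
    _ ≤ Real.circleAverage (fun z => (2 * (1 + p) / (1 - p)) • g z) 0 s := by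
        apply Real.circleAverage_mono
        · exact ContinuousOn.circleIntegrable hs0.le
            ((hpc _ h0s).smul ((continuousOn_ext hf hs1).norm.pow 2))
        · exact ContinuousOn.circleIntegrable hs0.le
            ((continuousOn_const (c := 2 * (1 + p) / (1 - p))).smul ((continuousOn_ext hf hs1).norm.pow 2))
        · intro z hz
          rw [abs_of_pos hs0] at hz
          have h1 := re_herglotzRieszKernel_le hz h0s
          have h2 : poissonKernel 0 (Φ 0) z ≤ (s + p) / (s - p) := by
            rw [poissonKernel_eq_re_herglotzRieszKernel]
            simpa [herglotzRieszKernel_def, hΦ0, hp] using h1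
          have h3 : (s + p) / (s - p) ≤ 2 * (1 + p) / (1 - p) := by
            rw [div_le_div_iff₀ (by linarith) (by linarith)]
            nlinarith
          have h4 : 0 ≤ g z := by positivity
          exact mul_le_mul_of_nonneg_right (h2.trans h3) h4
    _ = (2 * (1 + p) / (1 - p)) * sqMean f s := by
        rw [Real.circleAverage_fun_smul]; rfl
    _ ≤ (2 * (1 + p) / (1 - p)) * M :=
        mul_le_mul_of_nonneg_left (hM s ⟨hs0, hs1⟩) hK

theorem comp_mem (f : HardySpace) {φ : 𝔻 → 𝔻} (hφ : IsAnalyticSelfMap φ) :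
    (f ∘ φ : 𝔻 → ℂ) ∈ hardySubmodule := by
  refine ⟨isAnalytic_comp f.isAnalytic hφ,
    (2 * (1 + ‖(φ 0 : ℂ)‖) / (1 - ‖(φ 0 : ℂ)‖)) * ‖f‖ ^ 2, ?_⟩
  rintro _ ⟨r, hr, rfl⟩
  exact sqMean_comp_le f.isAnalytic (M := ‖f‖ ^ 2) (fun r hr => f.isLUB_norm_sq.1 ⟨r, hr, rfl⟩)
    hφ hr

/-- The composition operator `f ↦ f ∘ φ` on `H²` induced by an analytic self-map `φ` of the open
unit disk, as a bounded operator. -/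
def compositionOperator (φ : 𝔻 → 𝔻) (hφ : IsAnalyticSelfMap φ) : HardySpace →L[ℂ] HardySpace :=
  LinearMap.mkContinuous
    { toFun := fun f => ⟨f ∘ φ, comp_mem f hφ⟩
      map_add' := fun _ _ => rfl
      map_smul' := fun _ _ => rfl }
    (Real.sqrt (2 * (1 + ‖(φ 0 : ℂ)‖) / (1 - ‖(φ 0 : ℂ)‖)))
    (fun f => by
      have hK : 0 ≤ 2 * (1 + ‖(φ 0 : ℂ)‖) / (1 - ‖(φ 0 : ℂ)‖) :=
        div_nonneg (by positivity) (by linarith [(φ 0).norm_lt_one])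
      apply le_of_sq_le_sq _ (by positivity)
      rw [mul_pow, Real.sq_sqrt hK]
      refine (HardySpace.isLUB_norm_sq _).2 ?_
      rintro _ ⟨r, hr, rfl⟩
      exact sqMean_comp_le f.isAnalytic (M := ‖f‖ ^ 2)
        (fun r hr => f.isLUB_norm_sq.1 ⟨r, hr, rfl⟩) hφ hr)

@[simp] theorem compositionOperator_apply {φ : 𝔻 → 𝔻} (hφ : IsAnalyticSelfMap φ)
    (f : HardySpace) (z : 𝔻) : compositionOperator φ hφ f z = f (φ z) := rfl

/-! ### Elliptic automorphisms -/

/-- Automorphisms of the open unit disk: biholomorphic self-maps. -/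
def IsAutomorphism (φ : 𝔻 → 𝔻) : Prop :=
  IsAnalyticSelfMap φ ∧ ∃ ψ : 𝔻 → 𝔻, IsAnalyticSelfMap ψ ∧
    Function.LeftInverse ψ φ ∧ Function.RightInverse ψ φ

/-- An automorphism of the disk is elliptic if it has a unique fixed point in the disk. -/
def IsElliptic (φ : 𝔻 → 𝔻) : Prop :=
  IsAutomorphism φ ∧ ∃! a : 𝔻, φ a = a

theorem IsElliptic.isAnalyticSelfMap {φ : 𝔻 → 𝔻} (h : IsElliptic φ) : IsAnalyticSelfMap φ :=
  h.1.1

/-- `φ` has finite order `n`: `n` is the least positive integer whose iterate of `φ` is the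
identity. -/
def HasOrder (φ : 𝔻 → 𝔻) (n : ℕ) : Prop :=
  IsLeast {k : ℕ | 0 < k ∧ ∀ z, φ^[k] z = z} n

/-! ### Complex symmetric operators -/

/-- A conjugation: a conjugate-linear isometric involution of a complex Hilbert space. The inner
product `inner ℂ x y` is conjugate-linear in `x`. -/
structure IsConjugation {H : Type*} [NormedAddCommGroup H] [InnerProductSpace ℂ H]
    (C : H → H) : Prop where
  conj_linear : ∀ (x y : H) (c d : ℂ),
    C (c • x + d • y) = starRingEnd ℂ c • C x + starRingEnd ℂ d • C y
  isometric : ∀ x y : H, inner ℂ (C x) (C y) = inner ℂ y x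
  involutive : ∀ x : H, C (C x) = x

/-- A bounded operator `T` is complex symmetric if `T = C T* C` for some conjugation `C`. -/
def IsComplexSymmetric {H : Type*} [NormedAddCommGroup H] [InnerProductSpace ℂ H]
    [CompleteSpace H] (T : H →L[ℂ] H) : Prop :=
  ∃ C : H → H, IsConjugation C ∧ ∀ x, T x = C (ContinuousLinearMap.adjoint T (C x))

end HardyDisc

end

open scoped Complex.UnitDisc

noncomputable section

namespace HardyDisc

open Metric Set Filter Topology ComplexConjugate

/-! ### Elements of the disk algebra -/

/-! Let `b = moebius a` be the involution exchanging `0` and `a`, and let `T` be the composition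
operator. By the Schwarz lemma `b ∘ φ = c • b` with `c` a primitive cube root of unity, so each
power `b ^ n` is an eigenvector of `T` with eigenvalue `c ^ n`. The proof compares an angle between
eigenvectors of `T` with the angles possible between eigenvectors of the adjoint.

On the unit circle `|b| = 1`, so `⟨b ^ 2, b⟩` has modulus `|a|`, while `b` and `b ^ 2` are unit
vectors. If `T = C T* C`, then `x = C b` and `y = C (b ^ 2)` are unit vectors with `|⟨x, y⟩| = |a|`.
Moreover `x` is orthogonal to `b ^ n` unless `n ≡ 1` mod 3, and `y` unless `n ≡ 2` mod 3
(`IsConjugation.inner_map_eq_zero`).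

The estimate `norm_inner_le_of_inner_moebiusPow` shows that unit vectors with these orthogonality
relations satisfy `|⟨x, y⟩| ≤ |a| / (1 + |a|²)`, which is less than `|a|` when `a ≠ 0`. It is a
computation in the orthonormal basis `e_n = (b ^ n - ā b ^ (n + 1)) / s`, `s² = 1 - |a|²`, where the
coefficients of a vector are differences of consecutive pairings with the `b ^ n`. Completeness of
this basis comes from expanding the reproducing kernels in it. -/

/-- A function holomorphic on the open unit disk and continuous up to the boundary, as an element
of `H²`. -/
def ofDiskAlgebra (F : ℂ → ℂ) (hF : DiffContOnCl ℂ F (ball 0 1)) : HardySpace :=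
  ⟨fun z => F z, by
    have hext : ∀ z : ℂ, ‖z‖ < 1 → ext (fun z : 𝔻 => F z) z = F z := fun z hz => by
      rw [ext_of_lt _ hz, Complex.UnitDisc.coe_mk]
    refine ⟨hF.differentiableOn.congr fun z hz => hext z (by simpa using hz), ?_⟩
    obtain ⟨M, hM⟩ := (isCompact_closedBall (0 : ℂ) 1).exists_bound_of_continuousOn
      hF.continuousOn_ball
    refine ⟨M ^ 2, ?_⟩
    rintro _ ⟨r, hr, rfl⟩
    have hz1 : ∀ z ∈ sphere (0 : ℂ) |r|, ‖z‖ < 1 := fun z hz => by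
      have : ‖z‖ = r := by simpa [abs_of_pos hr.1] using hz
      rw [this]; exact hr.2
    refine Real.circleAverage_mono_on_of_le_circle ?_ fun z hz => ?_
    · refine ContinuousOn.circleIntegrable hr.1.le (ContinuousOn.pow (ContinuousOn.norm ?_) 2)
      refine (hF.continuousOn_ball.mono ?_).congr fun z hz =>
        hext z (hz1 z (by rwa [abs_of_pos hr.1]))
      exact (sphere_subset_closedBall).trans (closedBall_subset_closedBall hr.2.le)
    · have h := hM z (by simpa using (hz1 z hz).le)
      rw [hext z (hz1 z hz)]
      exact pow_le_pow_left₀ (norm_nonneg _) h 2⟩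

@[simp] theorem ofDiskAlgebra_apply {F : ℂ → ℂ} (hF : DiffContOnCl ℂ F (ball 0 1)) (z : 𝔻) :
    ofDiskAlgebra F hF z = F z := rfl

theorem ext_ofDiskAlgebra {F : ℂ → ℂ} (hF : DiffContOnCl ℂ F (ball 0 1)) {z : ℂ} (hz : ‖z‖ < 1) :
    ext (ofDiskAlgebra F hF) z = F z := by
  rw [ext_of_lt _ hz, ofDiskAlgebra_apply, Complex.UnitDisc.coe_mk]

theorem tendsto_circleAverage {H : ℂ → ℂ} (hH : ContinuousOn H (closedBall 0 1)) :
    Tendsto (fun r => Real.circleAverage H 0 r) (𝓝[<] 1) (𝓝 (Real.circleAverage H 0 1)) := by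
  obtain ⟨M, hM⟩ := (isCompact_closedBall (0 : ℂ) 1).exists_bound_of_continuousOn hH
  have hmem : ∀ r ∈ Ioc (0 : ℝ) 1, ∀ θ, circleMap 0 r θ ∈ closedBall (0 : ℂ) 1 := fun r hr θ =>
    closedBall_subset_closedBall hr.2 (circleMap_mem_closedBall 0 hr.1.le θ)
  have hev := HardySpace.eventually_mem
  unfold Real.circleAverage
  refine Tendsto.const_smul ?_ _
  apply intervalIntegral.tendsto_integral_filter_of_dominated_convergence fun _ => M
  · filter_upwards [hev] with r hr
    exact (hH.comp_continuous (continuous_circleMap 0 r)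
      (hmem r (Ioo_subset_Ioc_self hr))).aestronglyMeasurable
  · filter_upwards [hev] with r hr
    exact Eventually.of_forall fun θ _ => hM _ (hmem r (Ioo_subset_Ioc_self hr) θ)
  · simp
  · refine Eventually.of_forall fun θ _ => ?_
    refine (hH _ (hmem 1 (by simp) θ)).tendsto.comp (tendsto_nhdsWithin_iff.2 ⟨?_, ?_⟩)
    · have : Continuous fun r : ℝ => circleMap 0 r θ := by unfold circleMap; fun_prop
      exact this.continuousWithinAt
    · filter_upwards [hev] with r hr using hmem r (Ioo_subset_Ioc_self hr) θ

/-- Continuity up to the boundary lets the limit of the means be taken on the unit circle itself,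
where `|moebius a z| = 1` becomes available. -/
theorem inner_ofDiskAlgebra {F G : ℂ → ℂ} (hF : DiffContOnCl ℂ F (ball 0 1))
    (hG : DiffContOnCl ℂ G (ball 0 1)) :
    inner ℂ (ofDiskAlgebra F hF) (ofDiskAlgebra G hG)
      = Real.circleAverage (fun z => conj (F z) * G z) 0 1 := by
  apply HardySpace.inner_eq_of_tendsto
  refine (tendsto_circleAverage ((Complex.continuous_conj.comp_continuousOn
    hF.continuousOn_ball).mul hG.continuousOn_ball)).congr' ?_
  filter_upwards [HardySpace.eventually_mem] with r hr
  refine Real.circleAverage_congr_sphere fun z hz => ?_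
  have hz1 : ‖z‖ < 1 := by
    have : ‖z‖ = r := by simpa [abs_of_pos hr.1] using hz
    rw [this]; exact hr.2
  simp only [ext_ofDiskAlgebra _ hz1]
  rfl

/-! ### Reproducing kernels -/

theorem one_sub_conj_mul_ne_zero {α z : ℂ} (hα : ‖α‖ < 1) (hz : ‖z‖ ≤ 1) : 1 - conj α * z ≠ 0 := by
  intro h
  have h1 : ‖conj α * z‖ = 1 := by rw [← sub_eq_zero.1 h, norm_one]
  rw [norm_mul, RCLike.norm_conj] at h1
  nlinarith [norm_nonneg α, norm_nonneg z]

theorem diffContOnCl_of_differentiableAt {F : ℂ → ℂ}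
    (h : ∀ z : ℂ, ‖z‖ ≤ 1 → DifferentiableAt ℂ F z) : DiffContOnCl ℂ F (ball 0 1) := by
  apply DifferentiableOn.diffContOnCl
  rw [closure_ball _ one_ne_zero]
  exact fun z hz => (h z (by simpa using hz)).differentiableWithinAt

theorem diffContOnCl_kernel (w : 𝔻) :
    DiffContOnCl ℂ (fun z => (1 - conj (w : ℂ) * z)⁻¹) (ball 0 1) :=
  diffContOnCl_of_differentiableAt fun z hz =>
    DifferentiableAt.inv (by fun_prop) (one_sub_conj_mul_ne_zero w.norm_lt_one hz)

/-- The reproducing kernel of `H²` at the point `w`. -/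
def kernel (w : 𝔻) : HardySpace := ofDiskAlgebra _ (diffContOnCl_kernel w)

theorem kernel_apply (w z : 𝔻) : kernel w z = (1 - conj (w : ℂ) * z)⁻¹ := rfl

/-- The Taylor coefficients of the kernel are the powers of `conj w`, so the `ℓ²` pairing is the
power series of `f` at `w`. -/
theorem inner_kernel (w : 𝔻) (f : HardySpace) : inner ℂ (kernel w) f = f w := by
  obtain ⟨b, hb, hsb⟩ := f.exists_coeffs
  have hw : ‖(w : ℂ)‖ < 1 := w.norm_lt_one
  have hk : HasCoeffs (fun n => conj (w : ℂ) ^ n) (ext (kernel w)) := fun z hz => by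
    rw [kernel, ext_ofDiskAlgebra _ hz]
    simp only [← mul_pow]
    apply hasSum_geometric_of_norm_lt_one
    rw [norm_mul, RCLike.norm_conj]
    nlinarith [norm_nonneg z, norm_nonneg (w : ℂ)]
  have hsk : Summable fun n => ‖conj (w : ℂ) ^ n‖ ^ 2 := by
    simp only [norm_pow, RCLike.norm_conj, ← pow_mul, mul_comm _ 2]
    simp only [pow_mul]
    exact summable_geometric_of_lt_one (by positivity) (by nlinarith [norm_nonneg (w : ℂ)])
  rw [HardySpace.inner_eq_tsum hk hb hsk hsb]
  have := (hb w hw).tsum_eq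
  rw [ext_coe] at this
  rw [← this]
  congr 1
  funext n
  simp [mul_comm]

/-! ### Powers of a Möbius involution -/

/-- The involutive automorphism of the unit disk exchanging `0` and `α`. -/
def moebius (α z : ℂ) : ℂ := (α - z) / (1 - conj α * z)

section
variable {α z : ℂ}

theorem differentiableAt_moebius (hα : ‖α‖ < 1) (hz : ‖z‖ ≤ 1) :
    DifferentiableAt ℂ (moebius α) z :=
  DifferentiableAt.div (by fun_prop) (by fun_prop) (one_sub_conj_mul_ne_zero hα hz)

/-- The sign of the right-hand side decides both facts about `moebius α`: it preserves the open disk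
and it preserves the unit circle. -/
theorem sq_norm_one_sub_conj_mul_sub (α z : ℂ) :
    ‖1 - conj α * z‖ ^ 2 - ‖α - z‖ ^ 2 = (1 - ‖α‖ ^ 2) * (1 - ‖z‖ ^ 2) := by
  simp only [← Complex.normSq_eq_norm_sq, Complex.normSq_apply]
  simp
  ring

theorem norm_moebius_lt_one (hα : ‖α‖ < 1) (hz : ‖z‖ < 1) : ‖moebius α z‖ < 1 := by
  have h := sq_norm_one_sub_conj_mul_sub α z
  have h0 := norm_pos_iff.2 (one_sub_conj_mul_ne_zero hα hz.le)
  rw [moebius, norm_div, div_lt_one h0]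
  have h1 : 0 < (1 - ‖α‖ ^ 2) * (1 - ‖z‖ ^ 2) :=
    mul_pos (by nlinarith [norm_nonneg α]) (by nlinarith [norm_nonneg z])
  exact lt_of_pow_lt_pow_left₀ 2 h0.le (by linarith)

theorem norm_moebius_eq_one (hα : ‖α‖ < 1) (hz : ‖z‖ = 1) : ‖moebius α z‖ = 1 := by
  have h := sq_norm_one_sub_conj_mul_sub α z
  have h0 := norm_pos_iff.2 (one_sub_conj_mul_ne_zero hα hz.le)
  rw [moebius, norm_div, div_eq_one_iff_eq h0.ne']
  rw [hz] at h
  exact (pow_left_inj₀ (norm_nonneg _) h0.le two_ne_zero).1 (by linarith)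

theorem one_sub_conj_mul_moebius (hα : ‖α‖ < 1) (hz : ‖z‖ ≤ 1) :
    1 - conj α * moebius α z = (1 - conj α * α) / (1 - conj α * z) := by
  have h0 := one_sub_conj_mul_ne_zero hα hz
  rw [moebius, eq_div_iff h0, sub_mul, mul_assoc, div_mul_cancel₀ _ h0]
  ring

theorem moebius_moebius (hα : ‖α‖ < 1) (hz : ‖z‖ ≤ 1) : moebius α (moebius α z) = z := by
  have h0 := one_sub_conj_mul_ne_zero hα hz
  have h1 := one_sub_conj_mul_ne_zero hα hα.le
  have h2 := one_sub_conj_mul_moebius hα hz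
  have h3 : α - moebius α z = z * (1 - conj α * α) / (1 - conj α * z) := by
    rw [moebius, eq_div_iff h0, sub_mul, div_mul_cancel₀ _ h0]
    ring
  rw [moebius, h2, h3, div_div_div_cancel_right₀ h0, mul_div_cancel_right₀ _ h1]

@[simp] theorem moebius_zero (α : ℂ) : moebius α 0 = α := by simp [moebius]

@[simp] theorem moebius_self (α : ℂ) : moebius α α = 0 := by simp [moebius]

end

theorem diffContOnCl_moebius_pow (a : 𝔻) (n : ℕ) :
    DiffContOnCl ℂ (fun z => moebius a z ^ n) (ball 0 1) :=
  diffContOnCl_of_differentiableAt fun _ hz => (differentiableAt_moebius a.norm_lt_one hz).pow n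

/-- The powers of a Möbius involution as elements of `H²`. -/
def moebiusPow (a : 𝔻) (n : ℕ) : HardySpace := ofDiskAlgebra _ (diffContOnCl_moebius_pow a n)

@[simp] theorem moebiusPow_apply (a : 𝔻) (n : ℕ) (z : 𝔻) : moebiusPow a n z = moebius a z ^ n := rfl

/-- On the unit circle the factor `conj (b ^ n) * b ^ n` is 1, and the mean value property evaluates
the average of the remaining `b ^ k` at the centre, where `b` equals `a`. -/
theorem inner_moebiusPow_add (a : 𝔻) (n k : ℕ) :
    inner ℂ (moebiusPow a n) (moebiusPow a (n + k)) = (a : ℂ) ^ k := by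
  rw [moebiusPow, moebiusPow, inner_ofDiskAlgebra]
  have h : Real.circleAverage (fun z => conj (moebius a z ^ n) * moebius a z ^ (n + k)) 0 1
      = Real.circleAverage (fun z => moebius a z ^ k) 0 1 := by
    refine Real.circleAverage_congr_sphere fun z hz => ?_
    have hz' : ‖moebius a z‖ = 1 := norm_moebius_eq_one a.norm_lt_one (by simpa using hz)
    simp only [pow_add, ← mul_assoc, Complex.conj_mul', norm_pow, hz']
    simp
  rw [h, DiffContOnCl.circleAverage (by simpa using diffContOnCl_moebius_pow a k), moebius_zero]

theorem inner_moebiusPow_add_left (a : 𝔻) (n k : ℕ) :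
    inner ℂ (moebiusPow a (n + k)) (moebiusPow a n) = conj (a : ℂ) ^ k := by
  rw [← inner_conj_symm, inner_moebiusPow_add, map_pow]

theorem norm_moebiusPow (a : 𝔻) (n : ℕ) : ‖moebiusPow a n‖ = 1 := by
  have h := inner_moebiusPow_add a n 0
  rw [add_zero, pow_zero, inner_self_eq_norm_sq_to_K] at h
  have h1 : ‖moebiusPow a n‖ ^ 2 = 1 := by
    apply Complex.ofReal_injective
    rw [Complex.ofReal_pow, Complex.ofReal_one]
    exact h
  exact (pow_eq_one_iff_of_nonneg (norm_nonneg _) two_ne_zero).1 h1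

/-! ### The Takenaka–Malmquist basis -/

/-- The reciprocal of the norm of the reproducing kernel at `a`. -/
def defect (a : 𝔻) : ℝ := Real.sqrt (1 - ‖(a : ℂ)‖ ^ 2)

theorem defect_pos (a : 𝔻) : 0 < defect a := Real.sqrt_pos.2 (by linarith [a.sq_norm_lt_one])

theorem defect_sq (a : 𝔻) : (defect a : ℂ) ^ 2 = 1 - conj (a : ℂ) * a := by
  rw [Complex.conj_mul', ← Complex.ofReal_pow, defect,
    Real.sq_sqrt (by linarith [a.sq_norm_lt_one])]
  push_cast; rfl

/-- The orthonormal basis of `H²` obtained from the monomials by the Möbius involution at `a`. -/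
def malmquist (a : 𝔻) (n : ℕ) : HardySpace :=
  ((defect a)⁻¹ : ℂ) • (moebiusPow a n - conj (a : ℂ) • moebiusPow a (n + 1))

theorem defect_smul_malmquist (a : 𝔻) (n : ℕ) :
    (defect a : ℂ) • malmquist a n = moebiusPow a n - conj (a : ℂ) • moebiusPow a (n + 1) := by
  rw [malmquist, smul_inv_smul₀ (by exact_mod_cast (defect_pos a).ne')]

theorem malmquist_apply (a : 𝔻) (n : ℕ) (z : 𝔻) : malmquist a n z
    = (defect a : ℂ)⁻¹ * (moebius a z ^ n * (1 - conj (a : ℂ) * moebius a z)) := by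
  have : malmquist a n z = (defect a : ℂ)⁻¹ *
      (moebius a z ^ n - conj (a : ℂ) * moebius a z ^ (n + 1)) := rfl
  rw [this]; ring

theorem inner_malmquist (a : 𝔻) (n m : ℕ) : inner ℂ (malmquist a n) (malmquist a m)
    = ((defect a : ℂ) ^ 2)⁻¹ * (inner ℂ (moebiusPow a n) (moebiusPow a m)
      - conj (a : ℂ) * inner ℂ (moebiusPow a n) (moebiusPow a (m + 1))
      - a * inner ℂ (moebiusPow a (n + 1)) (moebiusPow a m)
      + a * conj (a : ℂ) * inner ℂ (moebiusPow a (n + 1)) (moebiusPow a (m + 1))) := by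
  simp only [malmquist, inner_smul_left, inner_smul_right, inner_sub_left, inner_sub_right,
    map_inv₀, Complex.conj_ofReal, Complex.conj_conj]
  ring

/-- The Gram matrix of the powers of `b` consists of powers of `a` and `ā` depending only on the
difference of the exponents. In the four-term expansion the off-diagonal terms cancel in pairs, and
the diagonal leaves `1 - |a|²`, the square of `defect a`. -/
theorem orthonormal_malmquist (a : 𝔻) : Orthonormal ℂ (malmquist a) := by
  have hd : (defect a : ℂ) ^ 2 ≠ 0 := pow_ne_zero 2 (by exact_mod_cast (defect_pos a).ne')
  have hlt : ∀ n k, inner ℂ (malmquist a n) (malmquist a (n + (k + 1))) = 0 := fun n k => by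
    have h1 := inner_moebiusPow_add a (n + 1) k
    rw [show n + 1 + k = n + (k + 1) by ring] at h1
    have h2 := inner_moebiusPow_add a (n + 1) (k + 1)
    rw [show n + 1 + (k + 1) = n + (k + 1) + 1 by ring] at h2
    have h3 := inner_moebiusPow_add a n (k + 2)
    rw [show n + (k + 2) = n + (k + 1) + 1 by ring] at h3
    rw [inner_malmquist, inner_moebiusPow_add a n (k + 1), h1, h2, h3]
    ring
  rw [orthonormal_iff_ite]
  intro n m
  rcases lt_trichotomy n m with h | rfl | h
  · obtain ⟨k, rfl⟩ := Nat.exists_eq_add_of_lt h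
    rw [if_neg h.ne, add_assoc, hlt]
  · have h1 := inner_moebiusPow_add a n 0
    have h2 := inner_moebiusPow_add a (n + 1) 0
    rw [add_zero, pow_zero] at h1 h2
    rw [if_pos rfl, inner_malmquist, h1, h2, inner_moebiusPow_add a n 1,
      inner_moebiusPow_add_left a n 1, inv_mul_eq_one₀ hd, defect_sq]
    ring
  · obtain ⟨k, rfl⟩ := Nat.exists_eq_add_of_lt h
    rw [if_neg h.ne', add_assoc, ← inner_conj_symm, hlt, map_zero]

/-- The series converges absolutely because its terms have norms decaying like `|b w| ^ n`. Its
value at `z` is a geometric series with ratio `conj (b w) * b z`, which sums to the kernel. -/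
theorem hasSum_malmquist_kernel (a w : 𝔻) :
    HasSum (fun n => conj (malmquist a n w) • malmquist a n) (kernel w) := by
  have hb : ∀ z : 𝔻, ‖moebius a z‖ < 1 := fun z => norm_moebius_lt_one a.norm_lt_one z.norm_lt_one
  have hsum : Summable fun n => conj (malmquist a n w) • malmquist a n := by
    apply Summable.of_norm
    simp only [norm_smul, (orthonormal_malmquist a).1, RCLike.norm_conj, malmquist_apply, norm_mul,
      norm_pow, mul_one]
    exact ((summable_geometric_of_lt_one (norm_nonneg _) (hb w)).mul_right _).mul_left _
  convert! hsum.hasSum using 1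
  refine HardySpace.ext_fun fun z => ?_
  -- Evaluation at `z` is pairing with `kernel z`, hence continuous, so the sum in `H²` can be
  -- evaluated termwise.
  have h1 := hsum.hasSum.mapL (innerSL ℂ (kernel z))
  simp only [innerSL_apply_apply, inner_smul_right, inner_kernel] at h1
  have hq : ‖conj (moebius a w) * moebius a z‖ < 1 := by
    rw [norm_mul, RCLike.norm_conj]
    nlinarith [hb w, hb z, norm_nonneg (moebius a w), norm_nonneg (moebius a z)]
  have h2 := (hasSum_geometric_of_norm_lt_one hq).mul_left (((defect a : ℂ) ^ 2)⁻¹ *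
    (conj (1 - conj (a : ℂ) * moebius a w) * (1 - conj (a : ℂ) * moebius a z)))
  refine Eq.trans ?_ (h2.unique ?_)
  · have hw := one_sub_conj_mul_moebius a.norm_lt_one w.norm_lt_one.le
    have hz := one_sub_conj_mul_moebius a.norm_lt_one z.norm_lt_one.le
    -- The polarized form of `sq_norm_one_sub_conj_mul_sub`, divided by the two denominators.
    have hwz : 1 - conj (moebius a w) * moebius a z
        = (1 - conj (a : ℂ) * a) * (1 - conj (w : ℂ) * z)
          / (conj (1 - conj (a : ℂ) * w) * (1 - conj (a : ℂ) * z)) := by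
      have e1 := one_sub_conj_mul_ne_zero a.norm_lt_one z.norm_lt_one.le
      have e2 : conj (1 - conj (a : ℂ) * w) ≠ 0 := (map_ne_zero _).2
        (one_sub_conj_mul_ne_zero a.norm_lt_one w.norm_lt_one.le)
      rw [moebius, moebius, map_div₀, div_mul_div_comm, eq_div_iff (mul_ne_zero e2 e1), sub_mul,
        div_mul_cancel₀ _ (mul_ne_zero e2 e1)]
      simp
      ring
    rw [hwz, hw, hz, defect_sq, kernel_apply, map_div₀]
    have e1 := one_sub_conj_mul_ne_zero a.norm_lt_one z.norm_lt_one.le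
    have e2 : conj (1 - conj (a : ℂ) * w) ≠ 0 := (map_ne_zero _).2
      (one_sub_conj_mul_ne_zero a.norm_lt_one w.norm_lt_one.le)
    have e3 := one_sub_conj_mul_ne_zero a.norm_lt_one a.norm_lt_one.le
    have e4 := one_sub_conj_mul_ne_zero w.norm_lt_one z.norm_lt_one.le
    have e5 : conj (1 - conj (a : ℂ) * a) = 1 - conj (a : ℂ) * a := by simp [mul_comm]
    rw [e5]
    generalize 1 - conj (a : ℂ) * a = A at *
    generalize 1 - conj (w : ℂ) * z = B at *
    generalize conj (1 - conj (a : ℂ) * w) = D at *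
    generalize 1 - conj (a : ℂ) * z = E at *
    field_simp
  · convert! h1 using 1
    funext n
    rw [malmquist_apply, malmquist_apply]
    simp only [map_mul, map_inv₀, Complex.conj_ofReal, map_pow, mul_pow, pow_two, mul_inv]
    ring

/-- By the kernel expansion, such an `f` is orthogonal to every reproducing kernel, that is, it
vanishes at every point. -/
theorem eq_zero_of_inner_malmquist {a : 𝔻} {f : HardySpace}
    (h : ∀ n, inner ℂ (malmquist a n) f = 0) : f = 0 := by
  refine HardySpace.ext_fun fun w => ?_
  have h1 := (hasSum_malmquist_kernel a w).mapL (innerSL ℂ f)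
  simp only [innerSL_apply_apply, inner_smul_right, inner_eq_zero_symm.1 (h _), mul_zero] at h1
  rw [← inner_kernel w f]
  exact inner_eq_zero_symm.1 (h1.unique hasSum_zero)

/-- The functions `malmquist a n` as a Hilbert basis of `H²`. -/
def malmquistBasis (a : 𝔻) : HilbertBasis ℕ ℂ HardySpace :=
  HilbertBasis.mkOfOrthogonalEqBot (orthonormal_malmquist a) (by
    rw [Submodule.eq_bot_iff]
    intro f hf
    refine eq_zero_of_inner_malmquist (a := a) fun n => ?_
    exact (Submodule.mem_orthogonal _ _).1 hf _ (Submodule.subset_span ⟨n, rfl⟩))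

theorem malmquistBasis_apply (a : 𝔻) (n : ℕ) : malmquistBasis a n = malmquist a n := by
  rw [malmquistBasis, HilbertBasis.coe_mkOfOrthogonalEqBot]

/-! ### Rotation form of a self-map of finite order with a fixed point -/

/-- Conjugating by the involution moves the fixed point to `0`, where the Schwarz lemma applies;
finite order forces its equality case, a rotation. -/
theorem exists_moebius_comp_eq_mul {φ : 𝔻 → 𝔻} (hφ : IsAnalyticSelfMap φ) {a : 𝔻} (ha : φ a = a)
    (h3 : ∀ z, φ^[3] z = z) :
    ∃ c : ℂ, c ^ 3 = 1 ∧ ∀ z : 𝔻, moebius a (φ z) = c * moebius a z := by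
  have haα := a.norm_lt_one
  have h3' : ∀ z, φ (φ (φ z)) = z := h3
  set Φ : ℂ → ℂ := ext fun z => (φ z : ℂ) with hΦ
  have hΦc : ∀ z : 𝔻, Φ z = φ z := fun z => ext_coe _ z
  have hΦlt : ∀ z : ℂ, ‖z‖ < 1 → ‖Φ z‖ < 1 := fun z hz => by
    rw [hΦ, ext_of_lt _ hz]; exact (φ _).norm_lt_one
  set G : ℂ → ℂ := fun z => moebius a (Φ (moebius a z)) with hG
  have hGlt : ∀ z : ℂ, ‖z‖ < 1 → ‖G z‖ < 1 := fun z hz =>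
    norm_moebius_lt_one haα (hΦlt _ (norm_moebius_lt_one haα hz))
  have hGd : DifferentiableOn ℂ G (ball 0 1) := by
    have hb : DifferentiableOn ℂ (moebius a) (ball 0 1) := fun z hz =>
      (differentiableAt_moebius haα (mem_ball_zero_iff.1 hz).le).differentiableWithinAt
    have hbm : MapsTo (moebius a) (ball 0 1) (ball 0 1) := fun z hz =>
      mem_ball_zero_iff.2 (norm_moebius_lt_one haα (mem_ball_zero_iff.1 hz))
    have hΦm : MapsTo Φ (ball 0 1) (ball 0 1) := fun z hz =>
      mem_ball_zero_iff.2 (hΦlt z (mem_ball_zero_iff.1 hz))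
    exact hb.comp (DifferentiableOn.comp hφ hb hbm) (hΦm.comp hbm)
  have hGm : MapsTo G (ball 0 1) (closedBall 0 1) := fun z hz =>
    mem_closedBall_zero_iff.2 (hGlt z (mem_ball_zero_iff.1 hz)).le
  have hG0 : G 0 = 0 := by
    simp only [hG, moebius_zero, hΦc, ha, moebius_self]
  have hGb : ∀ w : 𝔻, G (moebius a w) = moebius a (φ w) := fun w => by
    simp only [hG, moebius_moebius haα w.norm_lt_one.le, hΦc]
  have hle : ∀ w : 𝔻, ‖moebius a (φ w)‖ ≤ ‖moebius a w‖ := fun w => by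
    rw [← hGb]
    exact Complex.norm_le_norm_of_mapsTo_ball hGd hGm hG0 (norm_moebius_lt_one haα w.norm_lt_one)
  have heq : ∀ w : 𝔻, ‖moebius a (φ w)‖ = ‖moebius a w‖ := fun w => by
    -- Two more applications of the Schwarz inequality lead from `φ w` back to `φ (φ (φ w)) = w`.
    refine le_antisymm (hle w) ?_
    have h := (hle (φ (φ w))).trans (hle (φ w))
    rwa [h3'] at h
  -- Any nonzero point of the disk would serve to witness equality in the Schwarz lemma; `w` is the
  -- point that `b` sends to `1 / 2`.
  have hhalf : ‖(1 / 2 : ℂ)‖ < 1 := by norm_num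
  set w : 𝔻 := Complex.UnitDisc.mk (moebius a (1 / 2)) (norm_moebius_lt_one haα hhalf)
  have hw : moebius a w = 1 / 2 := moebius_moebius haα hhalf.le
  have hds : ‖dslope G 0 (1 / 2)‖ = 1 / 1 := by
    have h1 := heq w
    rw [← hGb, hw] at h1
    rw [dslope_of_ne _ (by norm_num), slope_def_field, hG0, sub_zero, sub_zero, norm_div, h1]
    norm_num
  obtain ⟨c, -, hc⟩ := Complex.affine_of_mapsTo_ball_of_exists_norm_dslope_eq_div' hGd
    (by rwa [hG0]) ⟨_, mem_ball_zero_iff.2 hhalf, hds⟩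
  have hcφ : ∀ z : 𝔻, moebius a (φ z) = c * moebius a z := fun z => by
    rw [← hGb, hc (mem_ball_zero_iff.2 (norm_moebius_lt_one haα z.norm_lt_one)), hG0]
    simp [mul_comm]
  refine ⟨c, ?_, hcφ⟩
  have h := hcφ (φ (φ w))
  rw [h3', hcφ, hcφ, hw] at h
  linear_combination -2 * h

/-! ### The angle estimate -/

/-- Put `x_n = ⟨b ^ n, x⟩` and likewise `y_n`, so that `s ⟨e_n, x⟩ = x_n - a x_{n+1}`. Two
consecutive `x_n` are never both nonzero, and `x_0 = 0`, so Parseval gives `s² ‖x‖² = (1 + |a|²) ∑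
|x_n|²`; the same holds for `y`. In `s² ⟨x, y⟩` the supports leave only `-a ∑ conj x_n * y_{n+1}`,
and the inequality between arithmetic and geometric means finishes. -/
theorem norm_inner_le_of_inner_moebiusPow {a : 𝔻} {x y : HardySpace}
    (hx : ∀ n, n % 3 ≠ 1 → inner ℂ (moebiusPow a n) x = 0)
    (hy : ∀ n, n % 3 ≠ 2 → inner ℂ (moebiusPow a n) y = 0) :
    (1 + ‖(a : ℂ)‖ ^ 2) * ‖inner ℂ x y‖ ≤ ‖(a : ℂ)‖ * ((‖x‖ ^ 2 + ‖y‖ ^ 2) / 2) := by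
  set s := defect a with hs
  have hs0 : 0 < s := defect_pos a
  set ρ := ‖(a : ℂ)‖ with hρ
  have hcoef : ∀ (f : HardySpace) n, (s : ℂ) * inner ℂ (malmquistBasis a n) f
      = inner ℂ (moebiusPow a n) f - a * inner ℂ (moebiusPow a (n + 1)) f := fun f n => by
    have h := congrArg (fun g => inner ℂ g f) (defect_smul_malmquist a n)
    simpa only [inner_smul_left, inner_sub_left, Complex.conj_ofReal, Complex.conj_conj,
      ← malmquistBasis_apply] using h
  have hnorm : ∀ f : HardySpace, (∀ n, inner ℂ (moebiusPow a n) f = 0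
      ∨ inner ℂ (moebiusPow a (n + 1)) f = 0) → inner ℂ (moebiusPow a 0) f = 0 →
      HasSum (fun n => ‖inner ℂ (moebiusPow a n) f‖ ^ 2) (s ^ 2 * ‖f‖ ^ 2 / (1 + ρ ^ 2)) := by
    intro f hf hf0
    have h1 : HasSum (fun n => ‖inner ℂ (malmquistBasis a n) f‖ ^ 2) (‖f‖ ^ 2) := by
      have h := Complex.hasSum_re ((malmquistBasis a).hasSum_inner_mul_inner f f)
      convert! h using 1
      · funext n
        rw [← inner_conj_symm f, Complex.conj_mul', ← Complex.ofReal_pow, Complex.ofReal_re]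
      · exact (inner_self_eq_norm_sq (𝕜 := ℂ) f).symm
    have h2 : ∀ n, s ^ 2 * ‖inner ℂ (malmquistBasis a n) f‖ ^ 2
        = ‖inner ℂ (moebiusPow a n) f‖ ^ 2 + ρ ^ 2 * ‖inner ℂ (moebiusPow a (n + 1)) f‖ ^ 2 := by
      intro n
      have h := congrArg (fun t => ‖t‖ ^ 2) (hcoef f n)
      simp only [norm_mul, mul_pow, Complex.norm_real, Real.norm_eq_abs, sq_abs] at h
      rw [h]
      -- One of the two terms vanishes, so the squared norm has no cross term.
      rcases hf n with h0 | h0 <;> simp [h0, mul_pow, hρ]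
    have h3 := h1.mul_left (s ^ 2)
    simp only [h2] at h3
    have h4 : Summable fun n => ‖inner ℂ (moebiusPow a n) f‖ ^ 2 :=
      Summable.of_nonneg_of_le (fun n => by positivity)
        (fun n => le_add_of_nonneg_right (by positivity)) h3.summable
    -- The shifted sum omits only the term of index 0, which is zero by `hf0`; both sums therefore
    -- agree.
    have h5 := h4.hasSum.add (((hasSum_nat_add_iff' 1).2 h4.hasSum).mul_left (ρ ^ 2))
    simp only [Finset.range_one, Finset.sum_singleton, hf0, norm_zero] at h5
    have h6 := h3.unique h5
    convert! h4.hasSum using 1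
    rw [h6]
    field_simp
    ring
  have hX := hnorm x (fun n => by
    by_cases h : n % 3 = 1
    · exact Or.inr (hx _ (by omega))
    · exact Or.inl (hx _ h)) (hx 0 (by norm_num))
  have hY := hnorm y (fun n => by
    by_cases h : n % 3 = 2
    · exact Or.inr (hy _ (by omega))
    · exact Or.inl (hy _ h)) (hy 0 (by norm_num))
  have hY' := (hasSum_nat_add_iff' 1).2 hY
  simp only [Finset.range_one, Finset.sum_singleton, hy 0 (by norm_num), norm_zero] at hY'
  have hXY := ((malmquistBasis a).hasSum_inner_mul_inner x y).mul_left ((s : ℂ) ^ 2)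
  have hterm : ∀ n, (s : ℂ) ^ 2 * (inner ℂ x (malmquistBasis a n) * inner ℂ (malmquistBasis a n) y)
      = -a * (conj (inner ℂ (moebiusPow a n) x) * inner ℂ (moebiusPow a (n + 1)) y) := by
    intro n
    have h1 := congrArg conj (hcoef x n)
    rw [map_mul, Complex.conj_ofReal, inner_conj_symm] at h1
    have h2 : (s : ℂ) ^ 2 * (inner ℂ x (malmquistBasis a n) * inner ℂ (malmquistBasis a n) y)
      = (s * inner ℂ x (malmquistBasis a n)) * (s * inner ℂ (malmquistBasis a n) y) := by ring
    rw [h2, h1, hcoef y]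
    -- Residue 1 is the only one where an `x` term meets a `y` term: for `n ≡ 2` both `x_n` and
    -- `x_{n+1}` vanish, and for `n ≡ 0` both `y_n` and `y_{n+1}` do.
    by_cases h : n % 3 = 1
    · rw [hx (n + 1) (by omega), hy n (by omega)]
      simp only [mul_zero, sub_zero, zero_sub]
      ring
    · rw [hx n h]
      by_cases h' : n % 3 = 2
      · rw [hx (n + 1) (by omega)]; simp
      · rw [hy n h', hy (n + 1) (by omega)]; simp
  simp only [hterm] at hXY
  have hbound := ((hX.add hY').div_const 2).mul_left ρ
  have hle := hXY.norm_le_of_bounded hbound fun n => by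
    rw [norm_mul, norm_neg, norm_mul, RCLike.norm_conj]
    refine mul_le_mul_of_nonneg_left ?_ (norm_nonneg _)
    linarith [two_mul_le_add_sq ‖inner ℂ (moebiusPow a n) x‖ ‖inner ℂ (moebiusPow a (n + 1)) y‖]
  rw [norm_mul, norm_pow, Complex.norm_real, Real.norm_of_nonneg hs0.le] at hle
  have hs2 : 0 < s ^ 2 := by positivity
  refine le_of_mul_le_mul_left ?_ hs2
  have h1 : (0 : ℝ) < 1 + ρ ^ 2 := by positivity
  calc s ^ 2 * ((1 + ρ ^ 2) * ‖inner ℂ x y‖) = (1 + ρ ^ 2) * (s ^ 2 * ‖inner ℂ x y‖) := by ring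
    _ ≤ (1 + ρ ^ 2) * _ := mul_le_mul_of_nonneg_left hle h1.le
    _ = s ^ 2 * (ρ * ((‖x‖ ^ 2 + ‖y‖ ^ 2) / 2)) := by
      field_simp
      ring

/-! ### Conjugations and eigenvectors -/

section Conjugation
variable {H : Type*} [NormedAddCommGroup H] [InnerProductSpace ℂ H] {C : H → H}

theorem IsConjugation.map_smul (hC : IsConjugation C) (c : ℂ) (x : H) :
    C (c • x) = conj c • C x := by
  simpa using hC.conj_linear x 0 c 0

theorem IsConjugation.norm_map (hC : IsConjugation C) (x : H) : ‖C x‖ = ‖x‖ := by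
  have h := congrArg Complex.re (hC.isometric x x)
  have h1 : ‖C x‖ ^ 2 = ‖x‖ ^ 2 := by
    rw [← inner_self_eq_norm_sq (𝕜 := ℂ), ← inner_self_eq_norm_sq (𝕜 := ℂ)]; exact h
  exact (pow_left_inj₀ (norm_nonneg _) (norm_nonneg _) two_ne_zero).1 h1

/-- If `T = C T* C`, then `C` maps eigenvectors of `T` to vectors orthogonal to the eigenvectors
of `T` with other eigenvalues. -/
theorem IsConjugation.inner_map_eq_zero [CompleteSpace H] (hC : IsConjugation C) {T : H →L[ℂ] H}
    (hT : ∀ x, T x = C (ContinuousLinearMap.adjoint T (C x))) {x y : H} {c d : ℂ}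
    (hx : T x = c • x) (hy : T y = d • y) (hcd : c ≠ d) : inner ℂ y (C x) = 0 := by
  -- `C x` is an eigenvector of the adjoint for the conjugate eigenvalue, hence orthogonal to the
  -- other eigenspaces of `T`.
  have h1 : ContinuousLinearMap.adjoint T (C x) = conj c • C x := by
    rw [← hC.involutive (ContinuousLinearMap.adjoint T (C x)), ← hT, hx, hC.map_smul]
  have h2 := ContinuousLinearMap.adjoint_inner_right T y (C x)
  rw [h1, hy, inner_smul_left, inner_smul_right, ← sub_eq_zero, ← sub_mul, ← map_sub] at h2
  exact (mul_eq_zero.1 h2).resolve_left ((map_ne_zero _).2 (sub_ne_zero.2 hcd))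

end Conjugation

theorem pow_ne_pow_of_mod_three_ne {c : ℂ} (hc : c ^ 3 = 1) (hc1 : c ≠ 1) {m n : ℕ}
    (h : m % 3 ≠ n % 3) : c ^ m ≠ c ^ n := by
  have ho : orderOf c = 3 := orderOf_eq_prime hc hc1
  intro he
  rw [← pow_mod_orderOf c m, ← pow_mod_orderOf c n, ho] at he
  exact h (pow_injOn_Iio_orderOf (by simp [ho, Nat.mod_lt]) (by simp [ho, Nat.mod_lt]) he)

end HardyDisc

end

/-! ### Comparison of the two angles -/

theorem theorem3p5 (φ : 𝔻 → 𝔻) (hφ : HardyDisc.IsElliptic φ) (hord : HardyDisc.HasOrder φ 3)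
    (a : 𝔻) (ha : φ a = a) (ha0 : a ≠ 0) :
    ¬ HardyDisc.IsComplexSymmetric
        (HardyDisc.compositionOperator φ hφ.isAnalyticSelfMap) := by
  open HardyDisc in
  rintro ⟨C, hC, hT⟩
  obtain ⟨c, hc3, hc⟩ := exists_moebius_comp_eq_mul hφ.isAnalyticSelfMap ha hord.1.2
  -- If `c = 1`, then `b ∘ φ = b`, and injectivity of `b` makes `φ` the identity, against minimality
  -- of the order.
  have hc1 : c ≠ 1 := by
    rintro rfl
    have h1 : 3 ≤ 1 := hord.2 ⟨one_pos, fun z => by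
      have h := congrArg (moebius a) (hc z)
      rw [one_mul, moebius_moebius a.norm_lt_one (φ z).norm_lt_one.le,
        moebius_moebius a.norm_lt_one z.norm_lt_one.le] at h
      exact Complex.UnitDisc.coe_injective h⟩
    omega
  have heig : ∀ n, compositionOperator φ hφ.isAnalyticSelfMap (moebiusPow a n)
      = c ^ n • moebiusPow a n := fun n => HardySpace.ext_fun fun z => by
    rw [compositionOperator_apply, moebiusPow_apply, hc, mul_pow]
    rfl
  have horth : ∀ m n, n % 3 ≠ m % 3 → inner ℂ (moebiusPow a n) (C (moebiusPow a m)) = 0 :=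
    fun m n h => hC.inner_map_eq_zero hT (heig m) (heig n)
      (pow_ne_pow_of_mod_three_ne hc3 hc1 (Ne.symm h))
  -- The exponents 1 and 2 are consecutive, so `⟨b ^ 2, b⟩ = ā`, and they avoid the residue 0 as the
  -- estimate requires.
  have h := norm_inner_le_of_inner_moebiusPow (horth 1) (horth 2)
  have h21 := inner_moebiusPow_add_left a 1 1
  rw [hC.isometric, hC.norm_map, hC.norm_map, norm_moebiusPow, norm_moebiusPow, h21, pow_one,
    RCLike.norm_conj] at h
  have hpos : 0 < ‖(a : ℂ)‖ := norm_pos_iff.2 (by simpa using ha0)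
  -- Here `h` amounts to `(1 + |a|²) |a| ≤ |a|`, that is, `|a|³ ≤ 0`.
  nlinarith [pow_pos hpos 3]
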